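/- For a nonempty compact metric space $(X,\rho)$, $s\ge 0$ and $\varepsilon>0$, let $$\mathrm H^s_\varepsilon(X,\rho)=\inf\Big\{\sum_{k=1}^\infty(\operatorname{diam}_\rho E_k)^s:\ X=\bigcup_{k=1}^\infty E_k,\ \operatorname{diam}_\rho E_k<\varepsilon\text{ for all }k\Big\}$$ (with $0^0=1$ and $(\operatorname{diam}\emptyset)^s=0$), and let $\dim_{\mathrm H}(X,\rho,\varepsilon)=\sup\{s\ge 0:\mathrm H^s_\varepsilon(X,\rho)\ge 1\}$. For a continuous map $h:X\to X$ and $n\ge1$ put $\rho_n(x,y)=\max_{0\le i<n}\rho(h^i(x),h^i(y))$. The lower mean Hausdorff dimension of $(X,\rho,h)$ is $$\underline{\mathrm{mdim}}_{\mathrm H}(X,\rho,h)=\lim_{\varepsilon\to0}\ \liminf_{n\to\infty}\ \frac1n\dim_{\mathrm H}(X,\rho_n,\varepsilon)\in[0,\infty];$$ the limit exists because the inner quantity does not decrease as $\varepsilon$ decreases. **Proposition.** Let $(\mathbb M,d)$ and $(\mathbb E,d')$ be nonempty compact metric spaces, let $f:\mathbb M\to\mathbb M$ and $g:\mathbb E\to\mathbb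 E$ be continuous maps, and equip $\mathbb M\times\mathbb E$ with the metric $$(d\times d')\big((x_1,y_1),(x_2,y_2)\big)=\max\{d(x_1,x_2),\,d'(y_1,y_2)\}.$$ Then $$\underline{\mathrm{mdim}}_{\mathrm H}(\mathbb M\times\mathbb E,\,d\times d',\,f\times g)\ \ge\ \underline{\mathrm{mdim}}_{\mathrm H}(\mathbb M,d,f)+\underline{\mathrm{mdim}}_{\mathrm H}(\mathbb E,d',g).$$ -/

import Mathlib

namespace MeanHausdorff

open Filter Topology
open scoped ENNReal NNReal

noncomputable section

variable {X : Type*}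

/-- The diameter of a set `E` with respect to a metric `d`. -/
def diam (d : X → X → ℝ) (E : Set X) : ℝ≥0∞ :=
  ⨆ x ∈ E, ⨆ y ∈ E, ENNReal.ofReal (d x y)

open Classical in
/-- The power `(diam E) ^ s`, with the conventions `0 ^ 0 = 1` and `(diam ∅) ^ s = 0`. -/
def diamPow (d : X → X → ℝ) (s : ℝ≥0) (E : Set X) : ℝ≥0∞ :=
  if E = ∅ then 0 else diam d E ^ (s : ℝ)

/-- `H_ε^s(X, d)`: the infimum of `∑ (diam E_n) ^ s` over the countable covers of `X` by sets
`E_n` of diameter less than `ε`. -/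
def hausdorffPre (d : X → X → ℝ) (ε : ℝ) (s : ℝ≥0) : ℝ≥0∞ :=
  ⨅ (E : ℕ → Set X) (_ : ⋃ n, E n = Set.univ) (_ : ∀ n, diam d (E n) < ENNReal.ofReal ε),
    ∑' n, diamPow d s (E n)

/-- `dim_H(X, d, ε) = sup {s ≥ 0 : H_ε^s(X, d) ≥ 1}`, in `[0, ∞]`. -/
def dimHScale (d : X → X → ℝ) (ε : ℝ) : ℝ≥0∞ :=
  ⨆ (s : ℝ≥0) (_ : 1 ≤ hausdorffPre d ε s), (s : ℝ≥0∞)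

/-- The dynamical metric `d_n(x, y) = max {d(f^i x, f^i y) : 0 ≤ i < n}` (it is `0` for `n = 0`). -/
def dynDist (d : X → X → ℝ) (f : X → X) (n : ℕ) (x y : X) : ℝ :=
  ⨆ i : Fin n, d (f^[i] x) (f^[i] y)

/-- `liminf_{n → ∞} (1 / n) dim_H(X, d_n, ε)`. -/
def lowerMdimHAt (d : X → X → ℝ) (f : X → X) (ε : ℝ) : ℝ≥0∞ :=
  liminf (fun n : ℕ => dimHScale (dynDist d f n) ε / (n : ℝ≥0∞)) atTop

/-- The lower mean Hausdorff dimension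
`lim_{ε → 0} liminf_{n → ∞} (1 / n) dim_H(X, d_n, ε)`, in `[0, ∞]`. The inner quantity increases
as `ε` decreases, so the limit is a supremum; see `tendsto_lowerMdimHAt`. -/
def lowerMdimH (d : X → X → ℝ) (f : X → X) : ℝ≥0∞ :=
  ⨆ (ε : ℝ) (_ : 0 < ε), lowerMdimHAt d f ε

theorem dimHScale_antitone (d : X → X → ℝ) : Antitone (dimHScale d) := by
  intro ε₁ ε₂ h
  refine iSup_mono fun s => iSup_mono' fun hs => ⟨hs.trans ?_, le_rfl⟩
  refine iInf_mono fun E => iInf_mono fun _ => iInf_mono' fun hE => ⟨fun n => ?_, le_rfl⟩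
  exact (hE n).trans_le (ENNReal.ofReal_le_ofReal h)

theorem lowerMdimHAt_antitone (d : X → X → ℝ) (f : X → X) : Antitone (lowerMdimHAt d f) := by
  intro ε₁ ε₂ h
  refine liminf_le_liminf (Eventually.of_forall fun n => ?_)
  exact ENNReal.div_le_div_right (dimHScale_antitone _ h) _

/-- The supremum that defines `lowerMdimH` is the limit as `ε → 0`. -/
theorem tendsto_lowerMdimHAt (d : X → X → ℝ) (f : X → X) :
    Tendsto (lowerMdimHAt d f) (𝓝[>] 0) (𝓝 (lowerMdimH d f)) := by
  have h := (lowerMdimHAt_antitone d f).tendsto_nhdsGT 0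
  rwa [sSup_image] at h

end

end MeanHausdorff

/-!
Let `E k` be a cover of `X × Y` by sets of diameter `D k`. For each `x`, the second projections of
those `E k` whose first projection contains `x` cover `Y`, so if `H^t(Y) ≥ 1` the weights `D k ^ t`
cover every point of `X`, through the first projections, with total weight at least `1`. When
`H^s(X) ≥ 1`, a Vitali selection shows that the fivefold enlargements of a disjoint subfamily of any
finite cover have `s`-sum at least `1`; peeling off disjoint subfamilies one after the other extends
this to weighted covers and gives `∑ D k ^ t * (5 * D k) ^ s ≥ 1`. Once the `D k` are small, the
factor `5 ^ s` is absorbed by replacing the exponent `s + t` with `c * (s + t)` for a `c < 1`. How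
small depends on `c` only, not on `s`, `t` or the metrics, so the bound holds at the same scale for
all the dynamical metrics; hence it passes to the mean dimension, and then `c` tends to `1`.
-/

namespace MeanHausdorff

open Filter Metric Set Topology
open scoped ENNReal NNReal

variable {X Y Z ι : Type*}

theorem diam_empty (d : X → X → ℝ) : diam d ∅ = 0 := by simp [diam]

theorem diam_dist [PseudoMetricSpace X] (A : Set X) : diam dist A = ediam A := by
  simp only [diam, ediam, edist_dist]

theorem diamPow_empty (d : X → X → ℝ) (s : ℝ≥0) : diamPow d s ∅ = 0 := if_pos rfl

theorem diamPow_of_nonempty (d : X → X → ℝ) (s : ℝ≥0) {A : Set X} (hA : A.Nonempty) :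
    diamPow d s A = diam d A ^ (s : ℝ) := if_neg hA.ne_empty

theorem diamPow_le (d : X → X → ℝ) (s : ℝ≥0) (A : Set X) :
    diamPow d s A ≤ diam d A ^ (s : ℝ) := by
  rcases A.eq_empty_or_nonempty with rfl | hA
  · simp only [diamPow_empty, zero_le]
  · exact (diamPow_of_nonempty d s hA).le

theorem hausdorffPre_le_tsum [Countable ι] {d : X → X → ℝ} {ε : ℝ} (s : ℝ≥0) (hε : 0 < ε)
    {A : ι → Set X} (hcov : ⋃ k, A k = univ) (hA : ∀ k, diam d (A k) < ENNReal.ofReal ε) :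
    hausdorffPre d ε s ≤ ∑' k, diamPow d s (A k) := by
  have := Encodable.ofCountable ι
  rw [← tsum_iUnion_decode₂ (diamPow d s) (diamPow_empty d s) A]
  have hdiam (n : ℕ) : diam d (⋃ k ∈ Encodable.decode₂ ι n, A k) < ENNReal.ofReal ε :=
    Encodable.iUnion_decode₂_cases (C := fun B => diam d B < ENNReal.ofReal ε)
      (by simpa only [diam_empty, ENNReal.ofReal_pos]) hA
  exact iInf₂_le_of_le _ ((Encodable.iUnion_decode₂ A).trans hcov) (iInf_le _ hdiam)

theorem one_le_hausdorffPre_zero [Nonempty X] (d : X → X → ℝ) (ε : ℝ) :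
    1 ≤ hausdorffPre d ε 0 := by
  refine le_iInf₂ fun A hA => le_iInf fun _ => ?_
  obtain ⟨k, hk⟩ := mem_iUnion.1 (hA ▸ mem_univ (Classical.arbitrary X))
  calc 1 = diamPow d 0 (A k) := by
        rw [diamPow_of_nonempty d 0 ⟨_, hk⟩, NNReal.coe_zero, ENNReal.rpow_zero]
    _ ≤ ∑' k, diamPow d 0 (A k) := ENNReal.le_tsum k

/-! ### Weighted covers -/

theorem sum_indicator_le_one_of_pairwiseDisjoint {A : ι → Set X} {U : Finset ι}
    (hU : (U : Set ι).PairwiseDisjoint A) (x : X) :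
    ∑ k ∈ U, (A k).indicator (1 : X → ℝ≥0∞) x ≤ 1 := by
  by_cases hx : ∃ k ∈ U, x ∈ A k
  · obtain ⟨k, hk, hxk⟩ := hx
    refine (Finset.sum_eq_single_of_mem k hk fun j hj hjk => ?_).trans_le ?_
    · exact indicator_of_notMem (fun hxj => disjoint_left.1 (hU hj hk hjk) hxj hxk) _
    · exact indicator_le_self _ _ x
  · push Not at hx
    exact (Finset.sum_eq_zero fun k hk => indicator_of_notMem (hx k hk) _).trans_le zero_le

theorem sum_mul_eq_sum_tsub_indicator_mul_add {F U : Finset ι} (hUF : U ⊆ F) {w : ι → ℝ≥0∞}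
    {θ : ℝ≥0∞} (hθ : ∀ k ∈ U, θ ≤ w k) (a : ι → ℝ≥0∞) :
    ∑ k ∈ F, w k * a k =
      ∑ k ∈ F, (w k - (U : Set ι).indicator (fun _ => θ) k) * a k + θ * ∑ k ∈ U, a k := by
  classical
  rw [Finset.mul_sum, ← Finset.inter_eq_right.2 hUF, ← Finset.sum_ite_mem,
    Finset.inter_eq_right.2 hUF, ← Finset.sum_add_distrib]
  refine Finset.sum_congr rfl fun k _ => ?_
  by_cases hk : k ∈ U
  · rw [indicator_of_mem (Finset.mem_coe.2 hk), if_pos hk, ← add_mul,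
      tsub_add_cancel_of_le (hθ k hk)]
  · rw [indicator_of_notMem (mt Finset.mem_coe.1 hk), if_neg hk, tsub_zero, add_zero]

-- Lowering all weights on a disjoint subfamily `U` by its smallest weight `w m` lowers the
-- multiplicity of every point by at most `w m`, lowers the sum by at least `w m`, and makes the
-- index `m` redundant.
theorem le_sum_mul_of_le_sum_mul_indicator {A : ι → Set X} {c : ι → ℝ≥0∞} (F : Finset ι)
    (hF : ∀ G ⊆ F, ⋃ k ∈ G, A k = univ →
      ∃ U ⊆ G, (U : Set ι).PairwiseDisjoint A ∧ 1 ≤ ∑ k ∈ U, c k)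
    {w : ι → ℝ≥0∞} {T : ℝ≥0∞} (hT : ∀ x, T ≤ ∑ k ∈ F, w k * (A k).indicator 1 x) :
    T ≤ ∑ k ∈ F, w k * c k := by
  classical
  induction F using Finset.strongInduction generalizing w T with
  | H F ih =>
  by_cases hcov : ⋃ k ∈ F, A k = univ
  swap
  · obtain ⟨x, hx⟩ := (ne_univ_iff_exists_notMem _).1 hcov
    have hT0 : T ≤ 0 := (hT x).trans_eq <| Finset.sum_eq_zero fun k hk => by
      rw [indicator_of_notMem fun hxk => hx (mem_biUnion hk hxk), mul_zero]
    exact hT0.trans zero_le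
  obtain ⟨U, hUF, hdisj, hsum⟩ := hF F subset_rfl hcov
  have hUne : U.Nonempty := Finset.nonempty_of_sum_ne_zero (one_pos.trans_le hsum).ne'
  obtain ⟨m, hmU, hm⟩ := U.exists_min_image w hUne
  set v : ι → ℝ≥0∞ := fun k => w k - (U : Set ι).indicator (fun _ => w m) k with hv
  have hvm : v m = 0 := by
    simp only [hv, indicator_of_mem (Finset.mem_coe.2 hmU), tsub_self]
  have hsplit (a : ι → ℝ≥0∞) :
      ∑ k ∈ F, w k * a k = ∑ k ∈ F.erase m, v k * a k + w m * ∑ k ∈ U, a k := by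
    rw [Finset.sum_erase F (by rw [hvm, zero_mul])]
    exact sum_mul_eq_sum_tsub_indicator_mul_add hUF hm a
  have hrest : T - w m ≤ ∑ k ∈ F.erase m, v k * c k := by
    refine ih _ (Finset.erase_ssubset (hUF hmU))
      (fun G hG => hF G (hG.trans (Finset.erase_subset _ _))) fun x => tsub_le_iff_right.2 ?_
    calc T ≤ ∑ k ∈ F.erase m, v k * (A k).indicator 1 x +
          w m * ∑ k ∈ U, (A k).indicator 1 x := (hT x).trans_eq (hsplit _)
      _ ≤ ∑ k ∈ F.erase m, v k * (A k).indicator 1 x + w m := by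
        gcongr
        exact mul_le_of_le_one_right' (sum_indicator_le_one_of_pairwiseDisjoint hdisj x)
  calc T ≤ (T - w m) + w m := le_tsub_add
    _ ≤ ∑ k ∈ F.erase m, v k * c k + w m * ∑ k ∈ U, c k :=
      add_le_add hrest (le_mul_of_one_le_right' hsum)
    _ = ∑ k ∈ F, w k * c k := (hsplit c).symm

section PseudoMetricSpace

variable [PseudoMetricSpace X]

theorem ediam_biUnion_le {S : Set ι} {A : ι → Set X} {B : Set X} {r : ℝ≥0∞}
    (hAB : ∀ a ∈ S, (A a ∩ B).Nonempty) (hA : ∀ a ∈ S, ediam (A a) ≤ r) :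
    ediam (⋃ a ∈ S, A a) ≤ r + ediam B + r := by
  refine ediam_le fun x hx y hy => ?_
  obtain ⟨a, ha, hxa⟩ := mem_iUnion₂.1 hx
  obtain ⟨b, hb, hyb⟩ := mem_iUnion₂.1 hy
  obtain ⟨p, hpa, hpB⟩ := hAB a ha
  obtain ⟨q, hqb, hqB⟩ := hAB b hb
  calc edist x y ≤ edist x p + edist p q + edist q y := edist_triangle4 x p q y
    _ ≤ r + ediam B + r := by
      gcongr
      · exact (edist_le_ediam_of_mem hxa hpa).trans (hA a ha)
      · exact edist_le_ediam_of_mem hpB hqB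
      · exact (edist_le_ediam_of_mem hqb hyb).trans (hA b hb)

theorem exists_pairwiseDisjoint_ediam_enlargement_le (A : ι → Set X) {G : Finset ι}
    (hG : ∀ k ∈ G, ediam (A k) ≠ ∞) :
    ∃ U ⊆ G, (U : Set ι).PairwiseDisjoint A ∧ ∃ B : ι → Set X,
      ⋃ k ∈ G, A k ⊆ ⋃ k ∈ U, B k ∧ ∀ k ∈ U, ediam (B k) ≤ 5 * ediam (A k) := by
  classical
  let N : Finset ι := {k ∈ G | (A k).Nonempty}
  have hNG : N ⊆ G := Finset.filter_subset _ _
  obtain ⟨u, huN, hdisj, hmeet⟩ := Vitali.exists_disjoint_subfamily_covering_enlargement A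
    (N : Set ι) (fun k => (ediam (A k)).toReal) 2 one_lt_two (fun _ _ => ENNReal.toReal_nonneg)
    (∑ k ∈ N, (ediam (A k)).toReal)
    (fun k hk => Finset.single_le_sum (f := fun k => (ediam (A k)).toReal)
      (fun _ _ => ENNReal.toReal_nonneg) hk)
    (fun k hk => (Finset.mem_filter.1 hk).2)
  lift u to Finset ι using N.finite_toSet.subset huN
  have huG : u ⊆ G := (Finset.coe_subset.1 huN).trans hNG
  refine ⟨u, huG, hdisj, fun b => ⋃ a ∈ {a | (A a ∩ A b).Nonempty ∧ ediam (A a) ≤ 2 * ediam (A b)},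
    A a, fun x hx => ?_, fun b _ => ?_⟩
  · obtain ⟨a, ha, hxa⟩ := mem_iUnion₂.1 hx
    obtain ⟨b, hb, hab, hle⟩ := hmeet a (Finset.mem_filter.2 ⟨ha, x, hxa⟩)
    have hbfin : 2 * ediam (A b) ≠ ∞ := ENNReal.mul_ne_top ENNReal.ofNat_ne_top (hG b (huG hb))
    have hle' : ediam (A a) ≤ 2 * ediam (A b) := by
      rwa [← ENNReal.toReal_le_toReal (hG a ha) hbfin, ENNReal.toReal_mul, ENNReal.toReal_ofNat]
    exact mem_biUnion hb (mem_biUnion (show a ∈ {a | _} from ⟨hab, hle'⟩) hxa)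
  · calc ediam (⋃ a ∈ {a | (A a ∩ A b).Nonempty ∧ ediam (A a) ≤ 2 * ediam (A b)}, A a)
        ≤ 2 * ediam (A b) + ediam (A b) + 2 * ediam (A b) :=
          ediam_biUnion_le (fun _ ha => ha.1) (fun _ ha => ha.2)
      _ = 5 * ediam (A b) := by ring

theorem exists_pairwiseDisjoint_one_le_sum {ε : ℝ} {s : ℝ≥0} (hε : 0 < ε)
    (hs : 1 ≤ hausdorffPre (dist : X → X → ℝ) ε s) {A : ι → Set X} {G : Finset ι}
    (hcov : ⋃ k ∈ G, A k = univ) (hA : ∀ k ∈ G, 5 * ediam (A k) < ENNReal.ofReal ε) :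
    ∃ U ⊆ G, (U : Set ι).PairwiseDisjoint A ∧ 1 ≤ ∑ k ∈ U, (5 * ediam (A k)) ^ (s : ℝ) := by
  have hfin (k : ι) (hk : k ∈ G) : ediam (A k) ≠ ∞ :=
    (ENNReal.lt_top_of_mul_ne_top_right (hA k hk).ne_top (by norm_num)).ne
  obtain ⟨U, hUG, hdisj, B, hGB, hB⟩ := exists_pairwiseDisjoint_ediam_enlargement_le A hfin
  refine ⟨U, hUG, hdisj, ?_⟩
  have hcovB : ⋃ k : U, B k = univ := by
    rw [← univ_subset_iff, ← hcov]
    exact hGB.trans_eq (iUnion_subtype (· ∈ U) fun k => B k).symm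
  calc 1 ≤ hausdorffPre (dist : X → X → ℝ) ε s := hs
    _ ≤ ∑' k : U, diamPow dist s (B k) := hausdorffPre_le_tsum s hε hcovB fun k => by
      rw [diam_dist]
      exact (hB k k.2).trans_lt (hA k (hUG k.2))
    _ = ∑ k ∈ U, diamPow dist s (B k) := Finset.tsum_subtype U fun k => diamPow dist s (B k)
    _ ≤ ∑ k ∈ U, (5 * ediam (A k)) ^ (s : ℝ) := Finset.sum_le_sum fun k hk => by
      refine (diamPow_le dist s (B k)).trans (ENNReal.rpow_le_rpow ?_ s.coe_nonneg)
      exact (diam_dist (B k)).trans_le (hB k hk)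

theorem exists_isOpen_superset_of_eventually_ediam {A : Set X} {p : ℝ≥0∞ → Prop}
    (hp : ∀ᶠ D in 𝓝 (ediam A), p D) : ∃ U, IsOpen U ∧ A ⊆ U ∧ p (ediam U) := by
  have hbound : Tendsto (fun δ : ℝ≥0 => ediam A + 2 * δ) (𝓝[>] 0) (𝓝 (ediam A)) := by
    have hcont : Continuous fun δ : ℝ≥0 => ediam A + 2 * (δ : ℝ≥0∞) :=
      continuous_const.add
        ((ENNReal.continuous_const_mul ENNReal.ofNat_ne_top).comp ENNReal.continuous_coe)
    simpa only [ENNReal.coe_zero, mul_zero, add_zero] using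
      (hcont.tendsto 0).mono_left nhdsWithin_le_nhds
  have hthick : Tendsto (fun δ : ℝ≥0 => ediam (thickening δ A)) (𝓝[>] 0) (𝓝 (ediam A)) := by
    refine tendsto_of_tendsto_of_tendsto_of_le_of_le' tendsto_const_nhds hbound ?_
      (Eventually.of_forall fun δ => ediam_thickening_le δ)
    filter_upwards [self_mem_nhdsWithin] with δ hδ
    exact ediam_mono (self_subset_thickening (NNReal.coe_pos.2 hδ) A)
  obtain ⟨δ, hδp, hδ⟩ := ((hthick.eventually hp).and self_mem_nhdsWithin).exists
  exact ⟨thickening δ A, isOpen_thickening, self_subset_thickening (NNReal.coe_pos.2 hδ) A, hδp⟩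

theorem exists_isOpen_superset_mul_rpow_le {A : Set X} {a w η : ℝ≥0∞} (s : ℝ≥0)
    (hA : 5 * ediam A < a) (hw : w ≠ ∞) (hη : η ≠ 0) :
    ∃ U, IsOpen U ∧ A ⊆ U ∧ 5 * ediam U < a ∧
      w * (5 * ediam U) ^ (s : ℝ) ≤ w * (5 * ediam A) ^ (s : ℝ) + η := by
  have hfive : Continuous fun D : ℝ≥0∞ => 5 * D :=
    ENNReal.continuous_const_mul ENNReal.ofNat_ne_top
  have hpow : Continuous fun D : ℝ≥0∞ => w * (5 * D) ^ (s : ℝ) :=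
    (ENNReal.continuous_const_mul hw).comp (ENNReal.continuous_rpow_const.comp hfive)
  have hfin : w * (5 * ediam A) ^ (s : ℝ) ≠ ∞ :=
    ENNReal.mul_ne_top hw (ENNReal.rpow_ne_top_of_nonneg s.coe_nonneg hA.ne_top)
  have hev : ∀ᶠ D in 𝓝 (ediam A), w * (5 * D) ^ (s : ℝ) < w * (5 * ediam A) ^ (s : ℝ) + η :=
    (hpow.tendsto _).eventually_lt_const (ENNReal.lt_add_right hfin hη)
  obtain ⟨U, hUo, hAU, hUa, hUη⟩ := exists_isOpen_superset_of_eventually_ediam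
    (((hfive.tendsto _).eventually_lt_const hA).and hev)
  exact ⟨U, hUo, hAU, hUa, hUη.le⟩

end PseudoMetricSpace

theorem exists_finset_forall_lt_sum [TopologicalSpace X] [CompactSpace X] {f : ι → X → ℝ≥0∞}
    (hf : ∀ k, LowerSemicontinuous (f k)) {T : ℝ≥0∞} (hT : ∀ x, T < ∑' k, f k x) :
    ∃ F : Finset ι, ∀ x, T < ∑ k ∈ F, f k x := by
  obtain ⟨F, hF⟩ := isCompact_univ.elim_directed_cover
    (fun F : Finset ι => {x | T < ∑ k ∈ F, f k x})
    (fun F => (lowerSemicontinuous_sum fun k _ => hf k).isOpen_preimage T)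
    (fun x _ => by
      simpa only [ENNReal.tsum_eq_iSup_sum, lt_iSup_iff, mem_iUnion, mem_ofPred_eq] using hT x)
    (directed_of_isDirected_le fun F G hFG => ofPred_subset_ofPred.2 fun x hx =>
      hx.trans_le (Finset.sum_le_sum_of_subset hFG))
  exact ⟨F, fun x => hF (mem_univ x)⟩

theorem one_le_tsum_mul_of_one_le_tsum_mul_indicator [PseudoMetricSpace X] [CompactSpace X]
    [Countable ι] {ε : ℝ} {s : ℝ≥0} (hε : 0 < ε) (hs : 1 ≤ hausdorffPre (dist : X → X → ℝ) ε s)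
    {A : ι → Set X} (hA : ∀ k, 5 * ediam (A k) < ENNReal.ofReal ε) {w : ι → ℝ≥0∞}
    (hw : ∀ k, w k ≠ ∞) (hwA : ∀ x, 1 ≤ ∑' k, w k * (A k).indicator 1 x) :
    1 ≤ ∑' k, w k * (5 * ediam (A k)) ^ (s : ℝ) := by
  refine ENNReal.le_of_forall_pos_le_add fun η hη _ => ?_
  refine le_of_forall_lt_imp_le_of_dense fun T hT => ?_
  obtain ⟨η', hη'pos, hη'⟩ :=
    ENNReal.exists_pos_sum_of_countable' (ENNReal.coe_ne_zero.2 hη.ne') ι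
  choose U hUo hAU hUε hUw using fun k =>
    exists_isOpen_superset_mul_rpow_le s (hA k) (hw k) (hη'pos k).ne'
  have hlsc (k : ι) : LowerSemicontinuous fun x => w k * (U k).indicator (1 : X → ℝ≥0∞) x := by
    simp only [← indicator_const_mul, Pi.one_apply, mul_one]
    exact (hUo k).lowerSemicontinuous_indicator zero_le
  obtain ⟨F, hF⟩ := exists_finset_forall_lt_sum hlsc fun x => calc
    T < 1 := hT
    _ ≤ ∑' k, w k * (A k).indicator 1 x := hwA x
    _ ≤ ∑' k, w k * (U k).indicator 1 x := by
      gcongr with k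
      exact hAU k
  calc T ≤ ∑ k ∈ F, w k * (5 * ediam (U k)) ^ (s : ℝ) :=
      le_sum_mul_of_le_sum_mul_indicator F
        (fun G _ hG => exists_pairwiseDisjoint_one_le_sum hε hs hG fun k _ => hUε k)
        fun x => (hF x).le
    _ ≤ ∑ k ∈ F, (w k * (5 * ediam (A k)) ^ (s : ℝ) + η' k) := Finset.sum_le_sum fun k _ => hUw k
    _ ≤ ∑' k, (w k * (5 * ediam (A k)) ^ (s : ℝ) + η' k) := ENNReal.sum_le_tsum F
    _ = ∑' k, w k * (5 * ediam (A k)) ^ (s : ℝ) + ∑' k, η' k := ENNReal.tsum_add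
    _ ≤ ∑' k, w k * (5 * ediam (A k)) ^ (s : ℝ) + η := by gcongr

/-! ### Products -/

/-- The maximum metric on a product, for arbitrary distance functions on the factors. -/
abbrev prodDist (d : X → X → ℝ) (d' : Y → Y → ℝ) (p q : X × Y) : ℝ :=
  max (d p.1 q.1) (d' p.2 q.2)

theorem diam_fst_image_le (d : X → X → ℝ) (d' : Y → Y → ℝ) (E : Set (X × Y)) :
    diam d (Prod.fst '' E) ≤ diam (prodDist d d') E := by
  simp only [diam, iSup_image]
  exact iSup₂_mono fun p _ => iSup₂_mono fun q _ => ENNReal.ofReal_le_ofReal (le_max_left _ _)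

theorem diam_snd_image_le (d : X → X → ℝ) (d' : Y → Y → ℝ) (E : Set (X × Y)) :
    diam d' (Prod.snd '' E) ≤ diam (prodDist d d') E := by
  simp only [diam, iSup_image]
  exact iSup₂_mono fun p _ => iSup₂_mono fun q _ => ENNReal.ofReal_le_ofReal (le_max_right _ _)

theorem one_le_tsum_diamPow_mul_of_iUnion_eq_univ [PseudoMetricSpace X] [CompactSpace X]
    [Countable ι] {d' : Y → Y → ℝ} {ε : ℝ} {s t : ℝ≥0} (hε : 0 < ε)
    (hs : 1 ≤ hausdorffPre (dist : X → X → ℝ) ε s) (ht : 1 ≤ hausdorffPre d' ε t)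
    {E : ι → Set (X × Y)} (hE : ⋃ k, E k = univ)
    (hX : ∀ k, 5 * ediam (Prod.fst '' E k) < ENNReal.ofReal ε)
    (hY : ∀ k, diam d' (Prod.snd '' E k) < ENNReal.ofReal ε) :
    1 ≤ ∑' k, diamPow d' t (Prod.snd '' E k) * (5 * ediam (Prod.fst '' E k)) ^ (s : ℝ) := by
  refine one_le_tsum_mul_of_one_le_tsum_mul_indicator hε hs hX (fun k => ?_) fun x => ?_
  · exact ((diamPow_le d' t _).trans_lt
      (ENNReal.rpow_lt_top_of_nonneg t.coe_nonneg (hY k).ne_top)).ne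
  have hfibre : ⋃ k : {k | x ∈ Prod.fst '' E k}, Prod.snd '' E k = univ := by
    refine eq_univ_of_forall fun y => ?_
    obtain ⟨k, hk⟩ := mem_iUnion.1 (hE ▸ mem_univ (x, y))
    exact mem_iUnion.2 ⟨⟨k, mem_image_of_mem Prod.fst hk⟩, mem_image_of_mem Prod.snd hk⟩
  calc 1 ≤ hausdorffPre d' ε t := ht
    _ ≤ ∑' k : {k | x ∈ Prod.fst '' E k}, diamPow d' t (Prod.snd '' E k) :=
      hausdorffPre_le_tsum t hε hfibre fun k => hY k
    _ = ∑' k, {k | x ∈ Prod.fst '' E k}.indicator (fun k => diamPow d' t (Prod.snd '' E k)) k :=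
      tsum_subtype _ fun k => diamPow d' t (Prod.snd '' E k)
    _ = ∑' k, diamPow d' t (Prod.snd '' E k) * (Prod.fst '' E k).indicator 1 x := by
      classical
      simp only [indicator_apply, mem_ofPred_eq, Pi.one_apply, mul_ite, mul_one, mul_zero]

theorem rpow_mul_rpow_le {x y z : ℝ≥0∞} {c : ℝ≥0} (hx : x ≤ z ^ (c : ℝ)) (hy : y ≤ z ^ (c : ℝ))
    (s t : ℝ≥0) : x ^ (s : ℝ) * y ^ (t : ℝ) ≤ z ^ ((c * (s + t) : ℝ≥0) : ℝ) := by
  calc x ^ (s : ℝ) * y ^ (t : ℝ) ≤ (z ^ (c : ℝ)) ^ (s : ℝ) * (z ^ (c : ℝ)) ^ (t : ℝ) := by gcongr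
    _ = z ^ ((c * (s + t) : ℝ≥0) : ℝ) := by
      rw [← ENNReal.rpow_add_of_nonneg _ _ s.coe_nonneg t.coe_nonneg, ← ENNReal.rpow_mul,
        NNReal.coe_mul, NNReal.coe_add]

theorem one_le_hausdorffPre_prodDist [PseudoMetricSpace X] [CompactSpace X] {d' : Y → Y → ℝ}
    {ε : ℝ} {c s t : ℝ≥0} (hε : 0 < ε) (hc : ∀ D < ENNReal.ofReal (ε / 5), 5 * D ≤ D ^ (c : ℝ))
    (hs : 1 ≤ hausdorffPre (dist : X → X → ℝ) ε s) (ht : 1 ≤ hausdorffPre d' ε t) :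
    1 ≤ hausdorffPre (prodDist (dist : X → X → ℝ) d') (ε / 5) (c * (s + t)) := by
  refine le_iInf₂ fun E hE => le_iInf fun hEε => ?_
  let D (k : ℕ) : ℝ≥0∞ := diam (prodDist (dist : X → X → ℝ) d') (E k)
  have hX (k : ℕ) : ediam (Prod.fst '' E k) ≤ D k :=
    (diam_dist _).symm.trans_le (diam_fst_image_le dist d' (E k))
  have hDε (k : ℕ) : 5 * D k < ENNReal.ofReal ε := by
    rw [mul_comm, ← ENNReal.lt_div_iff_mul_lt (by norm_num) (by norm_num)]
    simpa only [ENNReal.ofReal_div_of_pos (show (0 : ℝ) < 5 by norm_num), ENNReal.ofReal_ofNat]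
      using hEε k
  have hY (k : ℕ) : diam d' (Prod.snd '' E k) ≤ D k := diam_snd_image_le dist d' (E k)
  have hD5 (k : ℕ) : D k ≤ 5 * D k := le_mul_of_one_le_left' (by norm_num)
  have hterm (k : ℕ) : diamPow d' t (Prod.snd '' E k) * (5 * ediam (Prod.fst '' E k)) ^ (s : ℝ) ≤
      diamPow (prodDist dist d') (c * (s + t)) (E k) := by
    rcases (E k).eq_empty_or_nonempty with hk | hk
    · simp only [hk, image_empty, diamPow_empty, zero_mul, le_refl]
    calc diamPow d' t (Prod.snd '' E k) * (5 * ediam (Prod.fst '' E k)) ^ (s : ℝ)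
        ≤ D k ^ (t : ℝ) * (5 * D k) ^ (s : ℝ) := by
          grw [diamPow_le, hY k, hX k]
      _ ≤ D k ^ ((c * (t + s) : ℝ≥0) : ℝ) :=
        rpow_mul_rpow_le ((hD5 k).trans (hc _ (hEε k))) (hc _ (hEε k)) t s
      _ = diamPow (prodDist dist d') (c * (s + t)) (E k) := by
        rw [add_comm t s, diamPow_of_nonempty _ _ hk]
  exact (one_le_tsum_diamPow_mul_of_iUnion_eq_univ hε hs ht hE
    (fun k => (mul_le_mul_right (hX k) 5).trans_lt (hDε k))
    (fun k => ((hY k).trans (hD5 k)).trans_lt (hDε k))).trans (ENNReal.tsum_le_tsum hterm)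

theorem mul_dimHScale_add_le [PseudoMetricSpace X] [CompactSpace X] [Nonempty X] [Nonempty Y]
    (d' : Y → Y → ℝ) {ε : ℝ} {c : ℝ≥0} (hε : 0 < ε)
    (hc : ∀ D < ENNReal.ofReal (ε / 5), 5 * D ≤ D ^ (c : ℝ)) :
    c * (dimHScale (dist : X → X → ℝ) ε + dimHScale d' ε) ≤
      dimHScale (prodDist (dist : X → X → ℝ) d') (ε / 5) := by
  simp only [dimHScale, mul_add, ENNReal.mul_iSup]
  refine ENNReal.biSup_add_biSup_le' ⟨0, one_le_hausdorffPre_zero _ _⟩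
    ⟨0, one_le_hausdorffPre_zero _ _⟩ fun s hs t ht => ?_
  rw [← mul_add, ← ENNReal.coe_add, ← ENNReal.coe_mul]
  exact le_iSup₂_of_le (c * (s + t)) (one_le_hausdorffPre_prodDist hε hc hs ht) le_rfl

theorem mul_dimHScale_add_le_of_isCompact_range [PseudoMetricSpace Z] {φ : X → Z}
    (hφ : IsCompact (range φ)) [Nonempty X] [Nonempty Y] (d' : Y → Y → ℝ) {ε : ℝ} {c : ℝ≥0}
    (hε : 0 < ε) (hc : ∀ D < ENNReal.ofReal (ε / 5), 5 * D ≤ D ^ (c : ℝ)) :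
    c * (dimHScale (fun x y => dist (φ x) (φ y)) ε + dimHScale d' ε) ≤
      dimHScale (prodDist (fun x y => dist (φ x) (φ y)) d') (ε / 5) := by
  let _ : PseudoMetricSpace X := PseudoMetricSpace.induced φ inferInstance
  have hind : IsInducing φ := ⟨rfl⟩
  have : CompactSpace X := ⟨by rwa [hind.isCompact_iff, image_univ]⟩
  exact mul_dimHScale_add_le d' hε hc

theorem eventually_forall_lt_mul_le_rpow {K : ℝ≥0∞} (hK : K ≠ ∞) {c : ℝ≥0} (hc : c < 1) :
    ∀ᶠ r in 𝓝 (0 : ℝ≥0∞), ∀ D < r, K * D ≤ D ^ (c : ℝ) := by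
  have hpos : (0 : ℝ) < 1 - c := sub_pos.2 (NNReal.coe_lt_one.2 hc)
  have hcont : Continuous fun r : ℝ≥0∞ => K * r ^ (1 - c : ℝ) :=
    (ENNReal.continuous_const_mul hK).comp ENNReal.continuous_rpow_const
  have hzero : K * 0 ^ (1 - c : ℝ) < 1 := by
    simp only [ENNReal.zero_rpow_of_pos hpos, mul_zero, one_pos]
  filter_upwards [(hcont.tendsto 0).eventually_lt_const hzero] with r hr D hD
  have hDr : K * D ^ (1 - c : ℝ) ≤ 1 := by grw [hD, hr]
  calc K * D = K * D ^ (1 - c : ℝ) * D ^ (c : ℝ) := by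
        rw [mul_assoc, ← ENNReal.rpow_add_of_nonneg _ _ hpos.le c.coe_nonneg, sub_add_cancel,
          ENNReal.rpow_one]
    _ ≤ D ^ (c : ℝ) := mul_le_of_le_one_left' hDr

/-! ### Product dynamics -/

/-- The first `n` points of the orbit of `x` under `f`. It turns the dynamical metric into the
pullback of the maximum metric on `Fin n → X`. -/
def orbitSegment (f : X → X) (n : ℕ) (x : X) (i : Fin n) : X := f^[i] x

theorem dynDist_dist [PseudoMetricSpace X] (f : X → X) (n : ℕ) :
    dynDist dist f n = fun x y => dist (orbitSegment f n x) (orbitSegment f n y) := by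
  funext x y
  refine le_antisymm (Real.iSup_le (dist_le_pi_dist (orbitSegment f n x) _) dist_nonneg) ?_
  refine (dist_pi_le_iff (Real.iSup_nonneg fun _ => dist_nonneg)).2 fun i => ?_
  exact le_ciSup (f := fun i : Fin n => dist (f^[i] x) (f^[i] y)) (Finite.bddAbove_range _) i

theorem continuous_orbitSegment [TopologicalSpace X] {f : X → X} (hf : Continuous f) (n : ℕ) :
    Continuous (orbitSegment f n) :=
  continuous_pi fun i => hf.iterate i

theorem dynDist_prodDist (d : X → X → ℝ) (d' : Y → Y → ℝ) (f : X → X) (g : Y → Y) (n : ℕ) :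
    dynDist (prodDist d d') (Prod.map f g) n = prodDist (dynDist d f n) (dynDist d' g n) := by
  funext p q
  cases n with
  | zero => simp only [dynDist, prodDist, Real.iSup_of_isEmpty, max_self]
  | succ n =>
    refine eq_of_forall_ge_iff fun a => ?_
    simp only [dynDist, prodDist, Prod.map_iterate, Prod.map_fst, Prod.map_snd, max_le_iff,
      ciSup_le_iff (Finite.bddAbove_range _), forall_and]

theorem liminf_add_liminf_le (u v : ι → ℝ≥0∞) (l : Filter ι) :
    liminf u l + liminf v l ≤ liminf (fun i => u i + v i) l := by
  simp only [liminf_eq_iSup_iInf]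
  refine ENNReal.biSup_add_biSup_le' ⟨univ, univ_mem⟩ ⟨univ, univ_mem⟩ fun s hs t ht => ?_
  exact le_iSup₂_of_le (s ∩ t) (inter_mem hs ht) <|
    le_iInf₂ fun i hi => add_le_add (iInf₂_le i hi.1) (iInf₂_le i hi.2)

theorem mul_lowerMdimHAt_add_le [PseudoMetricSpace X] [CompactSpace X] [Nonempty X] [Nonempty Y]
    {f : X → X} (hf : Continuous f) (d' : Y → Y → ℝ) (g : Y → Y) {ε : ℝ} {c : ℝ≥0} (hε : 0 < ε)
    (hc : ∀ D < ENNReal.ofReal (ε / 5), 5 * D ≤ D ^ (c : ℝ)) :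
    c * (lowerMdimHAt (dist : X → X → ℝ) f ε + lowerMdimHAt d' g ε) ≤
      lowerMdimHAt (prodDist (dist : X → X → ℝ) d') (Prod.map f g) (ε / 5) := by
  have hdim (n : ℕ) : c * (dimHScale (dynDist (dist : X → X → ℝ) f n) ε +
      dimHScale (dynDist d' g n) ε) ≤
        dimHScale (dynDist (prodDist (dist : X → X → ℝ) d') (Prod.map f g) n) (ε / 5) := by
    rw [dynDist_prodDist, dynDist_dist]
    exact mul_dimHScale_add_le_of_isCompact_range
      (isCompact_range (continuous_orbitSegment hf n)) _ hε hc
  grw [lowerMdimHAt, lowerMdimHAt, liminf_add_liminf_le,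
    ← ENNReal.liminf_const_mul_of_ne_top ENNReal.coe_ne_top]
  refine liminf_le_liminf (Eventually.of_forall fun n => ?_)
  rw [ENNReal.div_add_div_same, ← mul_div_assoc]
  exact ENNReal.div_le_div_right (hdim n) _

end MeanHausdorff

open MeanHausdorff Filter Topology in
theorem mainTheorem4_general {M E : Type*} [PseudoMetricSpace M] [CompactSpace M] [Nonempty M]
    [Nonempty E] {f : M → M} (hf : Continuous f) (d' : E → E → ℝ) (g : E → E) :
    lowerMdimH (dist : M → M → ℝ) f + lowerMdimH d' g ≤
      lowerMdimH (prodDist (dist : M → M → ℝ) d') (Prod.map f g) := by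
  refine ENNReal.le_of_forall_lt_one_mul_le fun c hc => ?_
  lift c to NNReal using hc.ne_top
  have hlim : Tendsto (fun ε => c * (lowerMdimHAt (dist : M → M → ℝ) f ε + lowerMdimHAt d' g ε))
      (𝓝[>] 0) (𝓝 (c * (lowerMdimH (dist : M → M → ℝ) f + lowerMdimH d' g))) :=
    ENNReal.Tendsto.const_mul ((tendsto_lowerMdimHAt _ f).add (tendsto_lowerMdimHAt d' g))
      (Or.inr ENNReal.coe_ne_top)
  have hscale : Tendsto (fun ε : ℝ => ENNReal.ofReal (ε / 5)) (𝓝[>] 0) (𝓝 0) := by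
    have hcont : Continuous fun ε : ℝ => ENNReal.ofReal (ε / 5) :=
      ENNReal.continuous_ofReal.comp (continuous_id.div_const 5)
    simpa only [zero_div, ENNReal.ofReal_zero] using (hcont.tendsto 0).mono_left nhdsWithin_le_nhds
  refine le_of_tendsto hlim ?_
  filter_upwards [self_mem_nhdsWithin, hscale.eventually <|
    eventually_forall_lt_mul_le_rpow (K := 5) ENNReal.ofNat_ne_top (ENNReal.coe_lt_one_iff.1 hc)]
    with ε hε hεc
  exact (mul_lowerMdimHAt_add_le hf d' g hε hεc).trans
    (le_iSup₂_of_le (ε / 5) (div_pos hε (by norm_num)) le_rfl)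

/-- The lower mean Hausdorff dimension of a product system, with respect to the max metric, is at
least the sum of the lower mean Hausdorff dimensions of the factors. -/
theorem mainTheorem4 {M : Type*} {E : Type*} [MetricSpace M] [CompactSpace M] [Nonempty M]
    [MetricSpace E] [CompactSpace E] [Nonempty E]
    (f : M → M) (hf : Continuous f) (g : E → E) (hg : Continuous g) :
    MeanHausdorff.lowerMdimH (fun x y : M => dist x y) f +
        MeanHausdorff.lowerMdimH (fun x y : E => dist x y) g ≤
      MeanHausdorff.lowerMdimH
        (fun p q : M × E => max (dist p.1 q.1) (dist p.2 q.2)) (Prod.map f g) := by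
  exact mainTheorem4_general hf dist g
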